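/- Let $n\ge 1$ and consider the $n$-dimensional AWGN channel $Y=X+Z$, where $Z$ has independent $N(0,1)$ entries and is independent of $X$, used without memory under the amplitude constraint $\|X\|\le A$, $A>0$ (Euclidean norm). All logarithms are natural, and $$C=C_n(A)=\lim_{m\to\infty}\frac1m\,\sup I(X^m;Y^m)$$ is its capacity in nats per $n$-dimensional symbol, the supremum being over all laws of $X^m=(X_1,\dots,X_m)$ with $\|X_i\|\le A$ almost surely for every $i$. Let $\mathrm{Vol}(A)$ be the volume of the $n$-dimensional ball of radius $A$, and $$k_n(A)=\sum_{i=0}^{n-1}\binom{n-1}{i}\frac{\Gamma\left(\frac{n-i}{2}\right)}{2^{i/2}\,\Gamma\left(\frac n2\right)}\,A^i .$$ (i) $k_n(A)$ is a normalizing constant: for $\beta\in[0,1]$ and $k>0$ the function $$q(y)=\begin{cases}\dfrac{\beta}{\mathrm{Vol}(A)}, & \|y\|\le A,\\[2mm] \dfrac{1-\beta}{k\,(2\pi)^{n/2}}\,e^{-(\|y\|-A)^2/2}, & \|y\|>A,\end{cases}$$ is a probability density on $\mathbb R^n$ if and only if $k=k_n(A)$ or $\beta=1$. (ii) The limit defining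 $C_n(A)$ exists, and $$C_n(A)\le\log\left(k_n(A)+\frac{\mathrm{Vol}(A)}{(2\pi e)^{n/2}}\right).$$ (iii) For every signal-to-noise ratio $P>0$, that is, with $A=\sqrt{nP}$, $$C_n(\sqrt{nP})\le\min\left\{\log\left(k_n(\sqrt{nP})+\frac{\mathrm{Vol}(\sqrt{nP})}{(2\pi e)^{n/2}}\right),\ \frac n2\log(1+P)\right\}.$$ -/

import Mathlib

open MeasureTheory ProbabilityTheory Filter Topology
open scoped ENNReal

noncomputable section

/-- Mutual information `I(X;Y) = D(P_{XY} ‖ P_X ⊗ P_Y)`, in nats. -/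
def mutualInfo {Ω α β : Type*} [MeasurableSpace Ω] [MeasurableSpace α] [MeasurableSpace β]
    (P : Measure Ω) (X : Ω → α) (Y : Ω → β) : ℝ≥0∞ :=
  InformationTheory.klDiv (P.map fun ω => (X ω, Y ω)) ((P.map X).prod (P.map Y))

/-- A block of `m` symbols, each of them a vector of `n`-dimensional Euclidean space. -/
abbrev Block (n m : ℕ) : Type := Fin m → EuclideanSpace ℝ (Fin n)

/-- The law of the noise block `Z^m`: independent symbols, each with independent standard
Gaussian coordinates. -/
def noiseLaw (n m : ℕ) : Measure (Block n m) :=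
  Measure.pi fun _ => stdGaussian (EuclideanSpace ℝ (Fin n))

/-- Laws of an input block `X^m` all of whose symbols satisfy `‖X_i‖ ≤ A` almost surely. -/
def PeakConstrained (n m : ℕ) (A : ℝ) (μ : Measure (Block n m)) : Prop :=
  IsProbabilityMeasure μ ∧ ∀ᵐ x ∂μ, ∀ i, ‖x i‖ ≤ A

/-- `I(X^m; Y^m)` for `X^m` of law `μ`, `Z^m` the noise block independent of `X^m`, and
`Y^m = X^m + Z^m`. -/
def awgnInfo (n m : ℕ) (μ : Measure (Block n m)) : ℝ≥0∞ :=
  mutualInfo (μ.prod (noiseLaw n m)) (fun ω => ω.1) (fun ω => ω.1 + ω.2)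

/-- `(1/m) sup I(X^m; Y^m)` over all input laws that satisfy the peak constraint. -/
def blockCapacity (n : ℕ) (A : ℝ) (m : ℕ) : ℝ≥0∞ :=
  (⨆ (μ : Measure (Block n m)) (_ : PeakConstrained n m A μ), awgnInfo n m μ) / (m : ℝ≥0∞)

/-- Capacity of the `n`-dimensional AWGN channel under the amplitude constraint `‖X‖ ≤ A`, in nats
per `n`-dimensional symbol: `lim_{m → ∞} (1/m) sup I(X^m; Y^m)`. It is written as a `limsup`, which
always makes sense and is the limit when that exists. -/
def awgnCapacity (n : ℕ) (A : ℝ) : ℝ≥0∞ :=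
  limsup (blockCapacity n A) atTop

/-- Volume of the `n`-dimensional Euclidean ball of radius `r`. -/
def ballVol (n : ℕ) (r : ℝ) : ℝ :=
  volume.real (Metric.closedBall (0 : EuclideanSpace ℝ (Fin n)) r)

/-- `k_n(A) = ∑_{i=0}^{n-1} C(n-1,i) Γ((n-i)/2) / (2^{i/2} Γ(n/2)) A^i`. -/
def kConst (n : ℕ) (A : ℝ) : ℝ :=
  ∑ i ∈ Finset.range n, ((n - 1).choose i : ℝ) *
    (Real.Gamma (((n : ℝ) - (i : ℝ)) / 2) /
      ((2 : ℝ) ^ ((i : ℝ) / 2) * Real.Gamma ((n : ℝ) / 2))) * A ^ i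

/-- The test function with mixing proportion `β` and constant `k`: uniform on the ball of radius
`A`, a split and scaled Gaussian outside of it. -/
def testDensity (n : ℕ) (A β k : ℝ) (y : EuclideanSpace ℝ (Fin n)) : ℝ :=
  if ‖y‖ ≤ A then β / ballVol n A
  else (1 - β) / (k * (2 * Real.pi) ^ ((n : ℝ) / 2)) * Real.exp (-(‖y‖ - A) ^ 2 / 2)

end

/-! ### Kullback–Leibler divergence and mutual information -/

/-! Both capacity bounds come from one duality argument. For any test output law `Q`, replacing the
true output marginal by the product of `m` copies of `Q` can only increase the divergence that
defines `I(X^m;Y^m)` (`klDiv_prod_snd_le`). Against a product law the log-density is a sum over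
symbols, so the information is at most `m` times any bound on `D(N(x,I) ‖ Q)` valid for all `‖x‖ ≤
A` (`awgnInfo_le_of_testLaw`).

For the first bound, write `K = k_n(A)`, `V = Vol(A)/(2πe)^{n/2}`, `L = log (K + V)`. With `β =
V/(K+V)` the two branches of the test density merge into `q(y) = e^{-L} (2π)^{-n/2} e^{-φ(y)/2}`,
where `φ` is `ballPenalty`: the value `n` on the ball, the squared distance to the ball outside.
Hence `D(N(x,I) ‖ Q) = L + (E φ(x+Z) - n)/2`, and everything rests on `E φ(x+Z) ≤ n` for `‖x‖ ≤ A`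
(`lintegral_ballPenalty_le`). In polar coordinates around `x`, convexity makes each ray leave the
ball once, at some radius `a`, and beyond it the distance to the ball is at most `r - a`. What
remains is a one-dimensional inequality with weight `r^{n-1} e^{-r²/2}`, proved by integration by
parts (`integral_sq_sub_mul_pow_mul_exp_le`).

The second bound takes `Q = N(0,(1+P)I)` and uses only `E‖x+Z‖² = ‖x‖² + n ≤ n(1+P)`. The limit
exists by Fekete's lemma: independent concatenation of inputs makes `sup I` superadditive, and the
duality bound makes it at most linear in `m`. The normalization claim is a radial integral, expanded
by the binomial theorem after shifting the radius by `A`. -/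

/-- Chain rule, then data processing under the second projection for the conditional term. This
inequality is the half of tensorization that superadditivity needs. -/
theorem klDiv_add_le_klDiv_prod {α β : Type*} [MeasurableSpace α] [MeasurableSpace β]
    (μ ν : Measure α) (ρ σ : Measure β) [IsProbabilityMeasure μ] [IsProbabilityMeasure ν]
    [IsProbabilityMeasure ρ] [IsProbabilityMeasure σ] :
    InformationTheory.klDiv μ ν + InformationTheory.klDiv ρ σ ≤
      InformationTheory.klDiv (μ.prod ρ) (ν.prod σ) := by
  rw [← Measure.compProd_const, ← Measure.compProd_const,
    InformationTheory.klDiv_compProd_eq_add]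
  gcongr
  rw [Measure.compProd_const, Measure.compProd_const]
  simpa using InformationTheory.klDiv_map_le (μ.prod ρ) (μ.prod σ) measurable_snd

/-- The chain rule gives `D(J ‖ P ⊗ Q) = D(J ‖ P ⊗ J_Y) + D(J_Y ‖ Q)`, and the last term is dropped.
Since the chain rule splits off the first coordinate, the argument runs on the swapped law, whose
disintegration is where the standard Borel assumption enters. -/
theorem klDiv_prod_snd_le {α β : Type*} [MeasurableSpace α] [MeasurableSpace β]
    [StandardBorelSpace α] [Nonempty α]
    (J : Measure (α × β)) (P : Measure α) (Q : Measure β) [IsProbabilityMeasure J]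
    [IsProbabilityMeasure P] [IsProbabilityMeasure Q] :
    InformationTheory.klDiv J (P.prod J.snd) ≤ InformationTheory.klDiv J (P.prod Q) := by
  set J' := J.map Prod.swap with hJ'
  have hp : IsProbabilityMeasure J' := Measure.isProbabilityMeasure_map (by fun_prop)
  have hfst : J'.fst = J.snd := by simp [hJ']
  have hp' : IsProbabilityMeasure J.snd := inferInstance
  have h1 : InformationTheory.klDiv J' (J.snd.prod P) ≤ InformationTheory.klDiv J' (Q.prod P) := by
    rw [← J'.disintegrate J'.condKernel, ← Measure.compProd_const, ← Measure.compProd_const, hfst,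
      InformationTheory.klDiv_compProd_eq_add J.snd Q]
    exact le_add_self
  have h2 : J'.map Prod.swap = J := by
    rw [hJ', Measure.map_map (by fun_prop) (by fun_prop)]; simp
  calc InformationTheory.klDiv J (P.prod J.snd)
      = InformationTheory.klDiv (J'.map Prod.swap) ((J.snd.prod P).map Prod.swap) := by
        rw [h2, Measure.prod_swap]
    _ ≤ _ := InformationTheory.klDiv_map_le _ _ measurable_swap
    _ ≤ _ := h1
    _ = InformationTheory.klDiv (J.map Prod.swap) ((P.prod Q).map Prod.swap) := by
        rw [Measure.prod_swap]
    _ ≤ _ := InformationTheory.klDiv_map_le _ _ measurable_swap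

theorem klDiv_withDensity_exp {α : Type*} [MeasurableSpace α] (J ν : Measure α)
    [IsProbabilityMeasure J] [IsProbabilityMeasure ν] (G : α → ℝ) (hG : Measurable G)
    (hJ : J = ν.withDensity fun a => ENNReal.ofReal (Real.exp (G a))) (hint : Integrable G J) :
    InformationTheory.klDiv J ν = ENNReal.ofReal (∫ a, G a ∂J) := by
  have hac : J ≪ ν := hJ ▸ withDensity_absolutelyContinuous _ _
  have hllr : llr J ν =ᵐ[J] G := by
    have : J.rnDeriv ν =ᵐ[ν] fun a => ENNReal.ofReal (Real.exp (G a)) := by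
      conv_lhs => rw [hJ]
      exact Measure.rnDeriv_withDensity ν (by fun_prop)
    filter_upwards [hac.ae_le this] with a ha
    rw [llr, ha, ENNReal.toReal_ofReal (Real.exp_pos _).le, Real.log_exp]
  rw [InformationTheory.klDiv_of_ac_of_integrable hac ((integrable_congr hllr).2 hint),
    integral_congr_ae hllr]
  simp

/-- On a box the indicator factorizes along with the density, and coordinates are independent under
the product measure, so the integral of the product is the product of the integrals. -/
theorem pi_withDensity {ι : Type*} [Fintype ι] {α : ι → Type*} [∀ i, MeasurableSpace (α i)]
    (Q : ∀ i, Measure (α i)) [∀ i, IsProbabilityMeasure (Q i)] (f : ∀ i, α i → ℝ≥0∞)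
    (hf : ∀ i, Measurable (f i)) [∀ i, SigmaFinite ((Q i).withDensity (f i))] :
    Measure.pi (fun i => (Q i).withDensity (f i)) =
      (Measure.pi Q).withDensity fun y => ∏ i, f i (y i) := by
  classical
  refine Measure.pi_eq fun s hs => ?_
  have hms : ∀ i, Measurable ((s i).indicator (f i)) := fun i => (hf i).indicator (hs i)
  have h := lintegral_prod_eq_prod_lintegral_of_indepFun (μ := Measure.pi Q) Finset.univ
    (fun i (y : ∀ i, α i) => (s i).indicator (f i) (y i))
    (iIndepFun_pi fun i => (hms i).aemeasurable) fun i => (hms i).comp (measurable_pi_apply i)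
  rw [withDensity_apply _ (MeasurableSet.univ_pi hs),
    ← lintegral_indicator (MeasurableSet.univ_pi hs)]
  calc _ = ∫⁻ y, ∏ i, (s i).indicator (f i) (y i) ∂Measure.pi Q := by
        refine lintegral_congr fun y => ?_
        by_cases hy : y ∈ Set.univ.pi s
        · rw [Set.indicator_of_mem hy]
          exact Finset.prod_congr rfl fun i _ => (Set.indicator_of_mem (hy i trivial) _).symm
        · rw [Set.indicator_of_notMem hy]
          obtain ⟨i, hi⟩ : ∃ i, y i ∉ s i := by simpa [Set.mem_pi] using hy
          exact (Finset.prod_eq_zero (Finset.mem_univ i) (Set.indicator_of_notMem hi _)).symm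
    _ = _ := h
    _ = _ := Finset.prod_congr rfl fun i _ => by
        rw [(measurePreserving_eval Q i).lintegral_comp (hms i), lintegral_indicator (hs i),
          withDensity_apply _ (hs i)]

/-! ### Upper bounds by a test output law -/

instance isProbabilityMeasure_noiseLaw (n m : ℕ) : IsProbabilityMeasure (noiseLaw n m) := by
  unfold noiseLaw; infer_instance

/-- Joint law of input and output block. -/
noncomputable def jointLaw (n m : ℕ) (μ : Measure (Block n m)) : Measure (Block n m × Block n m) :=
  (μ.prod (noiseLaw n m)).map fun ω => (ω.1, ω.1 + ω.2)

instance isProbabilityMeasure_jointLaw (n m : ℕ) (μ : Measure (Block n m))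
    [IsProbabilityMeasure μ] : IsProbabilityMeasure (jointLaw n m μ) :=
  Measure.isProbabilityMeasure_map (by fun_prop)

theorem awgnInfo_eq (n m : ℕ) (μ : Measure (Block n m)) [IsProbabilityMeasure μ] :
    awgnInfo n m μ =
      InformationTheory.klDiv (jointLaw n m μ) (μ.prod (jointLaw n m μ).snd) := by
  have h1 : (μ.prod (noiseLaw n m)).map (fun ω => ω.1) = μ := by
    simp
  have h2 : (jointLaw n m μ).snd = (μ.prod (noiseLaw n m)).map fun ω => ω.1 + ω.2 := by
    rw [Measure.snd, jointLaw, Measure.map_map (by fun_prop) (by fun_prop)]; rfl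
  rw [awgnInfo, mutualInfo, h1, h2, jointLaw]

theorem jointLaw_eq_withDensity (n m : ℕ) (μ : Measure (Block n m)) [IsProbabilityMeasure μ]
    (Q : Measure (EuclideanSpace ℝ (Fin n))) [IsProbabilityMeasure Q]
    (g : EuclideanSpace ℝ (Fin n) → EuclideanSpace ℝ (Fin n) → ℝ)
    (hg : Measurable (Function.uncurry g))
    (hdens : ∀ x, (stdGaussian (EuclideanSpace ℝ (Fin n))).map (fun z => x + z) =
      Q.withDensity fun y => ENNReal.ofReal (Real.exp (g x y))) :
    jointLaw n m μ = (μ.prod (Measure.pi fun _ => Q)).withDensity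
      fun p => ENNReal.ofReal (Real.exp (∑ i, g (p.1 i) (p.2 i))) := by
  have hgi : ∀ i : Fin m, Measurable fun p : Block n m × Block n m => g (p.1 i) (p.2 i) :=
    fun i => hg.comp (f := fun p : Block n m × Block n m => (p.1 i, p.2 i)) (by fun_prop)
  have hG : Measurable fun p : Block n m × Block n m =>
      ENNReal.ofReal (Real.exp (∑ i, g (p.1 i) (p.2 i))) := by fun_prop
  have hcond : ∀ x : Block n m, (noiseLaw n m).map (fun z => x + z) =
      (Measure.pi fun _ => Q).withDensity
        fun y => ENNReal.ofReal (Real.exp (∑ i, g (x i) (y i))) := by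
    intro x
    have : ∀ i, IsProbabilityMeasure
        ((stdGaussian (EuclideanSpace ℝ (Fin n))).map (fun z => x i + z)) :=
      fun i => Measure.isProbabilityMeasure_map (by fun_prop)
    have h1 := Measure.pi_map_pi (μ := fun _ : Fin m => stdGaussian (EuclideanSpace ℝ (Fin n)))
      (f := fun i z => x i + z) (fun i => by fun_prop)
    have : ∀ i, IsProbabilityMeasure
        (Q.withDensity fun y => ENNReal.ofReal (Real.exp (g (x i) y))) :=
      fun i => hdens (x i) ▸ this i
    have h2 := pi_withDensity (fun _ : Fin m => Q)
      (fun i y => ENNReal.ofReal (Real.exp (g (x i) y)))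
      (fun i => (Real.measurable_exp.comp (hg.comp measurable_prodMk_left)).ennreal_ofReal)
    simp only [hdens] at h1
    rw [h2] at h1
    refine h1.trans ?_
    congr 1
    funext y
    rw [Real.exp_sum, ENNReal.ofReal_prod_of_nonneg fun i _ => (Real.exp_pos _).le]
  ext s hs
  rw [jointLaw, Measure.map_apply (by fun_prop) hs,
    Measure.prod_apply (hs.preimage (by fun_prop)), withDensity_apply _ hs,
    ← lintegral_indicator hs, lintegral_prod _ (hG.indicator hs).aemeasurable]
  refine lintegral_congr fun x => ?_
  have h3 : MeasurableSet (Prod.mk x ⁻¹' s) := hs.preimage (by fun_prop)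
  have := congrArg (fun ρ => ρ (Prod.mk x ⁻¹' s)) (hcond x)
  rw [Measure.map_apply (by fun_prop) h3, withDensity_apply _ h3, ← lintegral_indicator h3] at this
  exact this

/-- The duality bound in single-letter form, with `g x` the log-density of `N(x,I)` relative to `Q`.
The quadratic growth condition `hc` supplies the integrability that turns the divergence into an
ordinary integral; since `hL` is uniform in `x`, the result does not depend on the input law. -/
theorem awgnInfo_le_of_testLaw (n m : ℕ) (A : ℝ) (μ : Measure (Block n m))
    (hμ : PeakConstrained n m A μ)
    (Q : Measure (EuclideanSpace ℝ (Fin n))) [IsProbabilityMeasure Q]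
    (g : EuclideanSpace ℝ (Fin n) → EuclideanSpace ℝ (Fin n) → ℝ)
    (hg : Measurable (Function.uncurry g))
    (hdens : ∀ x, (stdGaussian (EuclideanSpace ℝ (Fin n))).map (fun z => x + z) =
      Q.withDensity fun y => ENNReal.ofReal (Real.exp (g x y)))
    (c L : ℝ) (hc : ∀ x z, ‖x‖ ≤ A → |g x (x + z)| ≤ c * (1 + ‖z‖ ^ 2))
    (hL : ∀ x, ‖x‖ ≤ A → ∫ z, g x (x + z) ∂stdGaussian (EuclideanSpace ℝ (Fin n)) ≤ L) :
    awgnInfo n m μ ≤ ENNReal.ofReal (m * L) := by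
  have hμp := hμ.1
  set γ := stdGaussian (EuclideanSpace ℝ (Fin n)) with hγ
  have hgi : ∀ i : Fin m, Measurable fun p : Block n m × Block n m => g (p.1 i) (p.2 i) :=
    fun i => hg.comp (f := fun p : Block n m × Block n m => (p.1 i, p.2 i)) (by fun_prop)
  have hG : Measurable fun p : Block n m × Block n m => ∑ i, g (p.1 i) (p.2 i) := by fun_prop
  have hgz : ∀ i : Fin m, Measurable fun p : Block n m × Block n m => g (p.1 i) (p.1 i + p.2 i) :=
    fun i => hg.comp (f := fun p : Block n m × Block n m => (p.1 i, p.1 i + p.2 i)) (by fun_prop)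
  have hsq : Integrable (fun z : EuclideanSpace ℝ (Fin n) => c * (1 + ‖z‖ ^ 2)) γ :=
    ((integrable_const _).add (IsGaussian.memLp_two_id (μ := γ)).integrable_norm_pow').const_mul c
  have hint : ∀ i : Fin m, Integrable (fun p : Block n m × Block n m => g (p.1 i) (p.1 i + p.2 i))
      (μ.prod (noiseLaw n m)) := by
    intro i
    have h1 : Integrable (fun p : Block n m × Block n m => c * (1 + ‖p.2 i‖ ^ 2))
        (μ.prod (noiseLaw n m)) :=
      (integrable_comp_eval (μ := fun _ : Fin m => γ) (i := i) hsq).comp_snd μ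
    refine h1.mono' (hgz i).aestronglyMeasurable ?_
    have h2 : ∀ᵐ p ∂(μ.prod (noiseLaw n m)), ∀ i, ‖p.1 i‖ ≤ A :=
      Measure.quasiMeasurePreserving_fst.ae hμ.2
    filter_upwards [h2] with p hp using hc _ _ (hp i)
  have hJint : Integrable (fun p => ∑ i, g (p.1 i) (p.2 i)) (jointLaw n m μ) := by
    rw [jointLaw, integrable_map_measure hG.aestronglyMeasurable (by fun_prop)]
    exact integrable_finsetSum _ fun i _ => hint i
  have hkl := klDiv_withDensity_exp (jointLaw n m μ) (μ.prod (Measure.pi fun _ => Q)) _ hG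
    (jointLaw_eq_withDensity n m μ Q g hg hdens) hJint
  rw [awgnInfo_eq]
  refine (klDiv_prod_snd_le _ μ (Measure.pi fun _ => Q)).trans (hkl.le.trans ?_)
  refine ENNReal.ofReal_le_ofReal ?_
  rw [jointLaw, integral_map (by fun_prop) hG.aestronglyMeasurable]
  simp only [Pi.add_apply]
  rw [integral_finsetSum _ fun i _ => hint i]
  have : ∀ i : Fin m, ∫ p, g (p.1 i) (p.1 i + p.2 i) ∂(μ.prod (noiseLaw n m)) ≤ L := by
    intro i
    rw [integral_prod _ (hint i)]
    have h3 : ∀ x : Block n m, ∫ z, g (x i) (x i + z i) ∂noiseLaw n m =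
        ∫ z, g (x i) (x i + z) ∂γ := fun x =>
      integral_comp_eval (μ := fun _ : Fin m => γ) (i := i) (f := fun z => g (x i) (x i + z))
        (hg.comp (f := fun z => (x i, x i + z)) (by fun_prop)).aestronglyMeasurable
    calc _ ≤ ∫ _, L ∂μ := by
          refine integral_mono_ae (hint i).integral_prod_left (integrable_const L) ?_
          filter_upwards [hμ.2] with x hx
          simpa only [h3] using hL _ (hx i)
      _ = L := by simp
  calc _ ≤ ∑ _ : Fin m, L := Finset.sum_le_sum fun i _ => this i
    _ = m * L := by simp

/-! ### Existence of the limit -/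

theorem map_prodProdProdComm {α β γ δ : Type*} [MeasurableSpace α] [MeasurableSpace β]
    [MeasurableSpace γ] [MeasurableSpace δ] (a : Measure α) (b : Measure β) (c : Measure γ)
    (d : Measure δ) [SFinite a] [SFinite b] [SFinite c] [SFinite d] :
    ((a.prod b).prod (c.prod d)).map (fun p => ((p.1.1, p.2.1), (p.1.2, p.2.2))) =
      (a.prod c).prod (b.prod d) := by
  refine Measure.ext_of_lintegral _ fun f hf => ?_
  rw [lintegral_map hf (by fun_prop), lintegral_prod _ (by fun_prop),
    lintegral_prod _ (by fun_prop), lintegral_prod _ (by fun_prop), lintegral_prod _ (by fun_prop)]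
  refine lintegral_congr fun x => ?_
  have h1 : ∀ y, ∫⁻ p : γ × δ, f ((x, p.1), (y, p.2)) ∂(c.prod d) =
      ∫⁻ z, ∫⁻ w, f ((x, z), (y, w)) ∂d ∂c := fun y => lintegral_prod _ (by fun_prop)
  have h2 : ∀ z, ∫⁻ p : β × δ, f ((x, z), p) ∂(b.prod d) =
      ∫⁻ y, ∫⁻ w, f ((x, z), (y, w)) ∂d ∂b := fun z => lintegral_prod _ (by fun_prop)
  simp only [h1, h2]
  refine lintegral_lintegral_swap (Measurable.aemeasurable ?_)
  exact Measurable.lintegral_prod_right' (f := fun p : (β × γ) × δ => f ((x, p.1.2), (p.1.1, p.2)))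
    (by fun_prop)

/-- Concatenation of two blocks. -/
def blockAppend (n m k : ℕ) (p : Block n m × Block n k) : Block n (m + k) :=
  Fin.append p.1 p.2

/-- Splitting of a block. -/
def blockSplit (n m k : ℕ) (x : Block n (m + k)) : Block n m × Block n k :=
  (fun i => x (Fin.castAdd k i), fun j => x (Fin.natAdd m j))

@[fun_prop]
theorem measurable_blockAppend (n m k : ℕ) : Measurable (blockAppend n m k) := by
  refine measurable_pi_iff.2 fun i => ?_
  refine Fin.addCases (fun i => ?_) (fun j => ?_) i
  · simp only [blockAppend, Fin.append_left]; fun_prop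
  · simp only [blockAppend, Fin.append_right]; fun_prop

@[fun_prop]
theorem measurable_blockSplit (n m k : ℕ) : Measurable (blockSplit n m k) := by
  unfold blockSplit; fun_prop

theorem blockSplit_blockAppend (n m k : ℕ) (p : Block n m × Block n k) :
    blockSplit n m k (blockAppend n m k p) = p := by
  simp [blockSplit, blockAppend]

theorem blockAppend_add (n m k : ℕ) (p q : Block n m × Block n k) :
    blockAppend n m k p + blockAppend n m k q = blockAppend n m k (p + q) := by
  funext i
  refine Fin.addCases (fun i => ?_) (fun j => ?_) i <;> simp [blockAppend]

theorem map_blockAppend_noiseLaw (n m k : ℕ) :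
    ((noiseLaw n m).prod (noiseLaw n k)).map (blockAppend n m k) = noiseLaw n (m + k) := by
  symm
  refine Measure.pi_eq fun s hs => ?_
  rw [Measure.map_apply (by fun_prop) (MeasurableSet.univ_pi hs), Fin.prod_univ_add]
  have : blockAppend n m k ⁻¹' Set.univ.pi s =
      (Set.univ.pi fun i => s (Fin.castAdd k i)) ×ˢ (Set.univ.pi fun j => s (Fin.natAdd m j)) := by
    ext p
    simp only [Set.mem_preimage, Set.mem_univ_pi, Set.mem_prod, blockAppend]
    constructor
    · intro h
      exact ⟨fun i => by simpa using h (Fin.castAdd k i),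
        fun j => by simpa using h (Fin.natAdd m j)⟩
    · rintro ⟨h1, h2⟩ i
      refine Fin.addCases (fun i => ?_) (fun j => ?_) i
      · simpa using h1 i
      · simpa using h2 j
  rw [this, Measure.prod_prod, noiseLaw, noiseLaw, Measure.pi_pi, Measure.pi_pi]

theorem jointLaw_append (n m k : ℕ) (μ : Measure (Block n m)) (ν : Measure (Block n k))
    [IsProbabilityMeasure μ] [IsProbabilityMeasure ν] :
    jointLaw n (m + k) ((μ.prod ν).map (blockAppend n m k)) =
      ((jointLaw n m μ).prod (jointLaw n k ν)).map fun p =>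
        (blockAppend n m k (p.1.1, p.2.1), blockAppend n m k (p.1.2, p.2.2)) := by
  rw [jointLaw, ← map_blockAppend_noiseLaw, Measure.map_prod_map _ _ (by fun_prop) (by fun_prop),
    Measure.map_map (by fun_prop) (by fun_prop), jointLaw, jointLaw,
    Measure.map_prod_map _ _ (by fun_prop) (by fun_prop), Measure.map_map (by fun_prop)
    (by fun_prop), ← map_prodProdProdComm, Measure.map_map (by fun_prop) (by fun_prop)]
  congr 1
  funext p
  simp [blockAppend_add]

/-- With independent inputs the two blocks form independent channels, so joint law and product of
marginals are both products up to the regrouping `T`, and divergence is superadditive over products.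
-/
theorem awgnInfo_append (n m k : ℕ) (μ : Measure (Block n m)) (ν : Measure (Block n k))
    [IsProbabilityMeasure μ] [IsProbabilityMeasure ν] :
    awgnInfo n m μ + awgnInfo n k ν ≤
      awgnInfo n (m + k) ((μ.prod ν).map (blockAppend n m k)) := by
  have : IsProbabilityMeasure ((μ.prod ν).map (blockAppend n m k)) :=
    Measure.isProbabilityMeasure_map (by fun_prop)
  set J₁ := jointLaw n m μ
  set J₂ := jointLaw n k ν
  set T : (Block n m × Block n m) × (Block n k × Block n k) →
      Block n (m + k) × Block n (m + k) := fun p =>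
        (blockAppend n m k (p.1.1, p.2.1), blockAppend n m k (p.1.2, p.2.2)) with hT
  set S : Block n (m + k) × Block n (m + k) →
      (Block n m × Block n m) × (Block n k × Block n k) := fun q =>
    (((blockSplit n m k q.1).1, (blockSplit n m k q.2).1),
      ((blockSplit n m k q.1).2, (blockSplit n m k q.2).2)) with hS
  have hTm : Measurable T := by fun_prop
  have hSm : Measurable S := by fun_prop
  -- A measurable left inverse of `T` lets data processing be applied to `S`, so passing to the
  -- regrouped laws does not decrease the divergence.
  have hST : S ∘ T = id := by
    funext p
    simp [hS, hT, blockSplit_blockAppend]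
  have hback : ∀ ρ : Measure ((Block n m × Block n m) × (Block n k × Block n k)),
      (ρ.map T).map S = ρ := fun ρ => by rw [Measure.map_map hSm hTm, hST, Measure.map_id]
  have hJ := jointLaw_append n m k μ ν
  have hsnd : ((J₁.prod J₂).map T).snd = (J₁.snd.prod J₂.snd).map (blockAppend n m k) := by
    rw [Measure.snd, Measure.map_map (by fun_prop) hTm, Measure.snd, Measure.snd,
      Measure.map_prod_map _ _ (by fun_prop) (by fun_prop),
      Measure.map_map (by fun_prop) (by fun_prop)]
    rfl
  have hprod : ((μ.prod ν).map (blockAppend n m k)).prod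
      ((J₁.snd.prod J₂.snd).map (blockAppend n m k)) =
      ((μ.prod J₁.snd).prod (ν.prod J₂.snd)).map T := by
    rw [Measure.map_prod_map _ _ (by fun_prop) (by fun_prop), ← map_prodProdProdComm,
      Measure.map_map (by fun_prop) (by fun_prop)]
    rfl
  rw [awgnInfo_eq, awgnInfo_eq, awgnInfo_eq, hJ, hsnd, hprod]
  calc _ ≤ InformationTheory.klDiv (J₁.prod J₂) ((μ.prod J₁.snd).prod (ν.prod J₂.snd)) :=
        klDiv_add_le_klDiv_prod _ _ _ _
    _ = InformationTheory.klDiv (((J₁.prod J₂).map T).map S)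
        ((((μ.prod J₁.snd).prod (ν.prod J₂.snd)).map T).map S) := by rw [hback, hback]
    _ ≤ _ := InformationTheory.klDiv_map_le _ _ hSm

theorem PeakConstrained.append {n m k : ℕ} {A : ℝ} {μ : Measure (Block n m)}
    {ν : Measure (Block n k)} (hμ : PeakConstrained n m A μ) (hν : PeakConstrained n k A ν) :
    PeakConstrained n (m + k) A ((μ.prod ν).map (blockAppend n m k)) := by
  have := hμ.1
  have := hν.1
  refine ⟨Measure.isProbabilityMeasure_map (by fun_prop), ?_⟩
  have hms : MeasurableSet {x : Block n (m + k) | ∀ i, ‖x i‖ ≤ A} := by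
    simp only [Set.ofPred_forall]
    exact MeasurableSet.iInter fun i => measurableSet_le (by fun_prop) (by fun_prop)
  rw [ae_map_iff (by fun_prop) hms]
  filter_upwards [Measure.quasiMeasurePreserving_fst.ae hμ.2,
    Measure.quasiMeasurePreserving_snd.ae hν.2] with p h1 h2 i
  refine Fin.addCases (fun i => ?_) (fun j => ?_) i
  · simpa [blockAppend] using h1 i
  · simpa [blockAppend] using h2 j

/-- `sup I(X^m; Y^m)` over the peak-constrained input laws. -/
noncomputable def supInfo (n : ℕ) (A : ℝ) (m : ℕ) : ℝ≥0∞ :=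
  ⨆ (μ : Measure (Block n m)) (_ : PeakConstrained n m A μ), awgnInfo n m μ

theorem supInfo_add_le (n : ℕ) (A : ℝ) (hA : 0 ≤ A) (m k : ℕ) :
    supInfo n A m + supInfo n A k ≤ supInfo n A (m + k) := by
  have hne : ∀ m, ∃ μ, PeakConstrained n m A μ := fun m =>
    -- A witness is needed because suprema add only over nonempty index sets; the zero input is
    -- admissible.
    ⟨Measure.dirac 0, inferInstance, by
      rw [ae_dirac_iff]
      · simpa using fun _ => hA
      · simp only [Set.ofPred_forall]
        exact MeasurableSet.iInter fun i => measurableSet_le (by fun_prop) (by fun_prop)⟩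
  refine ENNReal.biSup_add_biSup_le' (hne m) (hne k) fun μ hμ ν hν => ?_
  have := hμ.1
  have := hν.1
  exact (awgnInfo_append n m k μ ν).trans
    (le_iSup₂ (f := fun (μ : Measure (Block n (m + k))) (_ : PeakConstrained n (m + k) A μ) =>
      awgnInfo n (m + k) μ) _ (hμ.append hν))

/-- Fekete's lemma applied to `-s`. The linear bound makes every `s m` finite, so real values lose
nothing, and bounds the quotients. -/
theorem tendsto_div_of_superadditive (s : ℕ → ℝ≥0∞) (hs : ∀ m k, s m + s k ≤ s (m + k)) (L : ℝ)
    (hL : ∀ m : ℕ, s m ≤ ENNReal.ofReal (m * L)) :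
    ∃ l : ℝ≥0∞, Tendsto (fun m : ℕ => s m / m) atTop (𝓝 l) := by
  have hfin : ∀ m, s m ≠ ∞ := fun m => ((hL m).trans_lt ENNReal.ofReal_lt_top).ne
  have hsub : Subadditive fun m => -(s m).toReal := fun m k => by
    have := ENNReal.toReal_mono (hfin _) (hs m k)
    rw [ENNReal.toReal_add (hfin _) (hfin _)] at this
    linarith
  have hbdd : BddBelow (Set.range fun m : ℕ => -(s m).toReal / m) := by
    refine ⟨-|L|, ?_⟩
    rintro _ ⟨m, rfl⟩
    rcases Nat.eq_zero_or_pos m with rfl | hm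
    · simp
    have hm' : (0 : ℝ) < m := by exact_mod_cast hm
    have h1 : (s m).toReal ≤ m * |L| := by
      refine ENNReal.toReal_le_of_le_ofReal (by positivity) ((hL m).trans ?_)
      exact ENNReal.ofReal_le_ofReal (by gcongr; exact le_abs_self L)
    rw [le_div_iff₀ hm']
    linarith
  have h := (hsub.tendsto_lim hbdd).neg
  refine ⟨ENNReal.ofReal (-hsub.lim), (ENNReal.tendsto_ofReal h).congr' ?_⟩
  filter_upwards [eventually_gt_atTop 0] with m hm
  have hm' : (0 : ℝ) < m := by exact_mod_cast hm
  rw [neg_div, neg_neg, ENNReal.ofReal_div_of_pos hm', ENNReal.ofReal_toReal (hfin m),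
    ENNReal.ofReal_natCast]

theorem tendsto_blockCapacity (n : ℕ) (A : ℝ) (hA : 0 ≤ A) (L : ℝ)
    (hL : ∀ m : ℕ, supInfo n A m ≤ ENNReal.ofReal (m * L)) :
    Tendsto (blockCapacity n A) atTop (𝓝 (awgnCapacity n A)) := by
  obtain ⟨l, hl⟩ := tendsto_div_of_superadditive (supInfo n A) (supInfo_add_le n A hA) L hL
  have hl' : Tendsto (blockCapacity n A) atTop (𝓝 l) := hl
  rwa [awgnCapacity, hl'.limsup_eq]

theorem awgnCapacity_le (n : ℕ) (A : ℝ) (L : ℝ) (hL0 : 0 ≤ L)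
    (hL : ∀ m : ℕ, supInfo n A m ≤ ENNReal.ofReal (m * L)) :
    (awgnCapacity n A : EReal) ≤ (L : EReal) := by
  have h : awgnCapacity n A ≤ ENNReal.ofReal L := by
    refine limsup_le_of_le (h := ?_)
    filter_upwards [eventually_gt_atTop 0] with m hm
    have h1 := hL m
    rw [ENNReal.ofReal_mul (by positivity), ENNReal.ofReal_natCast] at h1
    exact ENNReal.div_le_of_le_mul' h1
  calc (awgnCapacity n A : EReal) ≤ ((ENNReal.ofReal L : ℝ≥0∞) : EReal) := by exact_mod_cast h
    _ = L := by rw [EReal.coe_ennreal_ofReal, max_eq_left hL0]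

/-! ### The standard Gaussian measure -/

theorem integrable_exp_neg_mul_sq_norm (n : ℕ) {b : ℝ} (hb : 0 < b) :
    Integrable fun y : EuclideanSpace ℝ (Fin n) => Real.exp (-b * ‖y‖ ^ 2) := by
  -- The Bochner integral of a non-integrable function is zero, so a positive value already proves
  -- integrability.
  refine Integrable.of_integral_ne_zero ?_
  rw [GaussianFourier.integral_rexp_neg_mul_sq_norm hb]
  positivity

/-- Lebesgue density of the standard Gaussian measure. -/
noncomputable def stdGaussianPDF (n : ℕ) (y : EuclideanSpace ℝ (Fin n)) : ℝ :=
  ((2 * Real.pi) ^ ((n : ℝ) / 2))⁻¹ * Real.exp (-‖y‖ ^ 2 / 2)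

@[fun_prop]
theorem measurable_stdGaussianPDF (n : ℕ) : Measurable (stdGaussianPDF n) := by
  unfold stdGaussianPDF; fun_prop

theorem stdGaussianPDF_pos (n : ℕ) (y : EuclideanSpace ℝ (Fin n)) : 0 < stdGaussianPDF n y := by
  unfold stdGaussianPDF; positivity

/-- Both sides are finite measures with the same characteristic function, by the Gaussian Fourier
integral. -/
theorem stdGaussian_eq_withDensity (n : ℕ) :
    stdGaussian (EuclideanSpace ℝ (Fin n)) =
      volume.withDensity fun y => ENNReal.ofReal (stdGaussianPDF n y) := by
  have hint : Integrable (stdGaussianPDF n) := by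
    have := (integrable_exp_neg_mul_sq_norm n (b := 1 / 2) (by norm_num)).const_mul
      ((2 * Real.pi) ^ ((n : ℝ) / 2))⁻¹
    refine this.congr (ae_of_all _ fun y => ?_)
    simp only [stdGaussianPDF]
    ring_nf
  have hfin : IsFiniteMeasure
      (volume.withDensity fun y => ENNReal.ofReal (stdGaussianPDF n y)) :=
    isFiniteMeasure_withDensity_ofReal hint.2
  refine Measure.ext_of_charFun (funext fun t => ?_)
  rw [charFun_stdGaussian, charFun_apply,
    integral_withDensity_eq_integral_toReal_smul (by fun_prop) (ae_of_all _ fun y => by simp)]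
  have h := GaussianFourier.integral_cexp_neg_mul_sq_norm_add (b := 1 / 2) (by norm_num)
    Complex.I t
  have h2 : ∀ y : EuclideanSpace ℝ (Fin n),
      (ENNReal.ofReal (stdGaussianPDF n y)).toReal • Complex.exp ((inner ℝ y t : ℝ) * Complex.I) =
      (((2 * Real.pi) ^ ((n : ℝ) / 2))⁻¹ : ℝ) *
        Complex.exp (-(1 / 2) * ‖y‖ ^ 2 + Complex.I * (inner ℝ t y : ℝ)) := by
    intro y
    rw [ENNReal.toReal_ofReal (stdGaussianPDF_pos n y).le, Complex.real_smul, stdGaussianPDF,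
      Complex.exp_add, real_inner_comm]
    push_cast
    ring_nf
  simp only [h2]
  rw [integral_const_mul, h]
  have h3 : ((Real.pi : ℂ) / (1 / 2)) ^ ((Module.finrank ℝ (EuclideanSpace ℝ (Fin n)) : ℂ) / 2) =
      (((2 * Real.pi) ^ ((n : ℝ) / 2) : ℝ) : ℂ) := by
    rw [Complex.ofReal_cpow (by positivity)]
    simp
    ring_nf
  rw [h3, ← mul_assoc, ← Complex.ofReal_mul, inv_mul_cancel₀ (by positivity)]
  simp
  ring_nf

theorem map_add_stdGaussian (n : ℕ) (x : EuclideanSpace ℝ (Fin n)) :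
    (stdGaussian (EuclideanSpace ℝ (Fin n))).map (fun z => x + z) =
      volume.withDensity fun y => ENNReal.ofReal (stdGaussianPDF n (y - x)) := by
  ext s hs
  have hm : MeasurableSet ((fun z => x + z) ⁻¹' s) := hs.preimage (by fun_prop)
  rw [Measure.map_apply (by fun_prop) hs, stdGaussian_eq_withDensity, withDensity_apply _ hm,
    withDensity_apply _ hs, ← lintegral_indicator hm, ← lintegral_indicator hs,
    ← lintegral_add_left_eq_self
      (s.indicator fun y => ENNReal.ofReal (stdGaussianPDF n (y - x))) x]
  refine lintegral_congr fun z => ?_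
  by_cases hz : x + z ∈ s
  · rw [Set.indicator_of_mem hz, Set.indicator_of_mem (s := (fun z => x + z) ⁻¹' s) hz,
      add_sub_cancel_left]
  · rw [Set.indicator_of_notMem hz, Set.indicator_of_notMem (s := (fun z => x + z) ⁻¹' s) hz]

theorem map_add_stdGaussian_eq_withDensity_exp (n : ℕ) (q : EuclideanSpace ℝ (Fin n) → ℝ)
    (hq : Measurable q) (hq0 : ∀ y, 0 ≤ q y)
    (g : EuclideanSpace ℝ (Fin n) → EuclideanSpace ℝ (Fin n) → ℝ)
    (hg : Measurable (Function.uncurry g))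
    (h : ∀ x y, q y * Real.exp (g x y) = stdGaussianPDF n (y - x))
    (x : EuclideanSpace ℝ (Fin n)) :
    (stdGaussian (EuclideanSpace ℝ (Fin n))).map (fun z => x + z) =
      (volume.withDensity fun y => ENNReal.ofReal (q y)).withDensity
        fun y => ENNReal.ofReal (Real.exp (g x y)) := by
  have hgx : Measurable (g x) := hg.comp measurable_prodMk_left
  rw [map_add_stdGaussian, ← withDensity_mul _ (by fun_prop) (by fun_prop)]
  congr 1
  funext y
  rw [Pi.mul_apply, ← ENNReal.ofReal_mul (hq0 y), h]

theorem integrable_sq_norm_stdGaussian (n : ℕ) :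
    Integrable (fun z : EuclideanSpace ℝ (Fin n) => ‖z‖ ^ 2)
      (stdGaussian (EuclideanSpace ℝ (Fin n))) :=
  (IsGaussian.memLp_two_id (μ := stdGaussian (EuclideanSpace ℝ (Fin n)))).integrable_norm_pow'

theorem integral_sq_norm_stdGaussian (n : ℕ) :
    ∫ z, ‖z‖ ^ 2 ∂stdGaussian (EuclideanSpace ℝ (Fin n)) = n := by
  have hi : ∀ i : Fin n, ∫ z, z i ^ 2 ∂stdGaussian (EuclideanSpace ℝ (Fin n)) = 1 ∧
      Integrable (fun z => z i ^ 2) (stdGaussian (EuclideanSpace ℝ (Fin n))) := by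
    intro i
    have hz : ∀ z : EuclideanSpace ℝ (Fin n),
        innerSL ℝ (EuclideanSpace.single i (1 : ℝ)) z = z i := fun z => by
      simp [EuclideanSpace.inner_single_left]
    have h1 := variance_dual_stdGaussian (innerSL ℝ (EuclideanSpace.single i (1 : ℝ)))
    rw [variance_of_integral_eq_zero (by fun_prop) (integral_strongDual_stdGaussian _)] at h1
    have h2 := (IsGaussian.memLp_dual (stdGaussian (EuclideanSpace ℝ (Fin n)))
      (innerSL ℝ (EuclideanSpace.single i (1 : ℝ))) 2 (by simp)).integrable_sq
    simp only [hz] at h1 h2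
    exact ⟨by simpa using h1, h2⟩
  simp only [EuclideanSpace.real_norm_sq_eq]
  rw [integral_finsetSum _ fun i _ => (hi i).2]
  simp [(hi _).1]

theorem integral_sq_norm_add_stdGaussian (n : ℕ) (x : EuclideanSpace ℝ (Fin n)) :
    Integrable (fun z => ‖x + z‖ ^ 2) (stdGaussian (EuclideanSpace ℝ (Fin n))) ∧
    ∫ z, ‖x + z‖ ^ 2 ∂stdGaussian (EuclideanSpace ℝ (Fin n)) = ‖x‖ ^ 2 + n := by
  have h1 : Integrable (fun z => 2 * innerSL ℝ x z) (stdGaussian (EuclideanSpace ℝ (Fin n))) :=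
    (IsGaussian.integrable_dual _ _).const_mul 2
  have h2 := integral_strongDual_stdGaussian (innerSL ℝ x)
  have h3 := (integrable_const (‖x‖ ^ 2) (μ := stdGaussian (EuclideanSpace ℝ (Fin n)))).add h1
  have h4 : (fun z => ‖x + z‖ ^ 2) = fun z => ‖x‖ ^ 2 + 2 * innerSL ℝ x z + ‖z‖ ^ 2 :=
    funext fun z => by rw [norm_add_sq_real]; rfl
  rw [h4]
  refine ⟨h3.add (integrable_sq_norm_stdGaussian n), ?_⟩
  rw [integral_add (by exact h3) (integrable_sq_norm_stdGaussian n),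
    integral_add (integrable_const _) h1,
    integral_const_mul, h2, integral_sq_norm_stdGaussian]
  simp

/-! ### Expected squared distance to the ball -/

/-- Polar coordinates for functions that need not be radial: seen from an off-centre `x`, the ball
penalty depends on the direction. -/
theorem lintegral_eq_lintegral_toSphere (n : ℕ) (hn : 1 ≤ n)
    (f : EuclideanSpace ℝ (Fin n) → ℝ≥0∞) (hf : Measurable f) :
    ∫⁻ y, f y = ∫⁻ θ : Metric.sphere (0 : EuclideanSpace ℝ (Fin n)) 1,
      (∫⁻ r in Set.Ioi (0 : ℝ),
        ENNReal.ofReal (r ^ (n - 1)) * f (r • (θ : EuclideanSpace ℝ (Fin n))))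
        ∂(volume : Measure (EuclideanSpace ℝ (Fin n))).toSphere := by
  set μ : Measure (EuclideanSpace ℝ (Fin n)) := volume with hμ
  have : Nonempty (Fin n) := ⟨⟨0, hn⟩⟩
  have hdim : Module.finrank ℝ (EuclideanSpace ℝ (Fin n)) = n := by simp
  have hmp := μ.measurePreserving_homeomorphUnitSphereProd
  have hF : Measurable fun p : Metric.sphere (0 : EuclideanSpace ℝ (Fin n)) 1 × Set.Ioi (0 : ℝ) =>
      f ((p.2 : ℝ) • (p.1 : EuclideanSpace ℝ (Fin n))) := by fun_prop
  have hms : MeasurableSet ({0}ᶜ : Set (EuclideanSpace ℝ (Fin n))) :=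
    (measurableSet_singleton _).compl
  calc ∫⁻ y, f y ∂μ = ∫⁻ y in {0}ᶜ, f y ∂μ := by rw [restrict_compl_singleton]
    _ = ∫⁻ y : ({0}ᶜ : Set (EuclideanSpace ℝ (Fin n))), f y ∂μ.comap (↑) :=
        (lintegral_subtype_comap hms f).symm
    _ = ∫⁻ p, f ((p.2 : ℝ) • (p.1 : EuclideanSpace ℝ (Fin n)))
          ∂(μ.toSphere.prod (Measure.volumeIoiPow (n - 1))) := by
        rw [hdim] at hmp
        rw [← hmp.lintegral_comp hF]
        refine lintegral_congr fun y => ?_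
        congr 1
        have hy : ‖(y : EuclideanSpace ℝ (Fin n))‖ ≠ 0 := norm_ne_zero_iff.2 y.2
        simp [smul_smul, hy]
    _ = _ := by
        rw [lintegral_prod _ hF.aemeasurable]
        refine lintegral_congr fun θ => ?_
        rw [Measure.volumeIoiPow, lintegral_withDensity_eq_lintegral_mul _ (by fun_prop)
          (by fun_prop)]
        exact lintegral_subtype_comap measurableSet_Ioi
          (fun r : ℝ => ENNReal.ofReal (r ^ (n - 1)) * f (r • (θ : EuclideanSpace ℝ (Fin n))))

theorem integrableOn_pow_mul_exp_neg_sq_div_two (k : ℕ) {a : ℝ} (ha : 0 ≤ a) :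
    IntegrableOn (fun r : ℝ => r ^ k * Real.exp (-r ^ 2 / 2)) (Set.Ioi a) := by
  have h := integrableOn_rpow_mul_exp_neg_mul_sq (b := 1 / 2) (by norm_num) (s := k)
    (by have : (0 : ℝ) ≤ k := k.cast_nonneg
        linarith)
  refine (h.mono_set (Set.Ioi_subset_Ioi ha)).congr_fun (fun r _ => ?_) measurableSet_Ioi
  simp only [Real.rpow_natCast]
  ring_nf

/-- The function `-(r - a) r^m e^{-r²/2}` vanishes at `a` and at infinity, so its derivative
integrates to zero. That derivative exceeds the difference of the two integrands by `a (r - a) r^m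
e^{-r²/2} + a m r^{m-1} e^{-r²/2} ≥ 0`. -/
theorem integral_sq_sub_mul_pow_mul_exp_le (m : ℕ) {a : ℝ} (ha : 0 ≤ a) :
    ∫ r in Set.Ioi a, (r - a) ^ 2 * (r ^ m * Real.exp (-r ^ 2 / 2)) ≤
      ∫ r in Set.Ioi a, ((m : ℝ) + 1) * (r ^ m * Real.exp (-r ^ 2 / 2)) := by
  have hI := fun k => integrableOn_pow_mul_exp_neg_sq_div_two k ha
  set e : ℝ → ℝ := fun r => Real.exp (-r ^ 2 / 2) with he
  have hde : ∀ r, HasDerivAt e (-r * e r) r := fun r => by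
    have h1 : HasDerivAt (fun r : ℝ => -r ^ 2 / 2) (-r) r := by
      have := ((hasDerivAt_pow 2 r).neg).div_const 2
      refine this.congr_deriv ?_
      simp only [Nat.cast_ofNat]
      ring
    refine h1.exp.congr_deriv ?_
    simp only [he]; ring
  -- For `m = 0` the truncated exponent `m - 1` is harmless, since its coefficient `a * m` is zero.
  have hG : ∀ r, HasDerivAt (fun r => -((r ^ (m + 1) - a * r ^ m) * e r))
      (r ^ (m + 2) * e r - a * (r ^ (m + 1) * e r) - (m + 1) * (r ^ m * e r) +
        a * m * (r ^ (m - 1) * e r)) r := fun r => by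
    refine ((((hasDerivAt_pow (m + 1) r).sub ((hasDerivAt_pow m r).const_mul a)).mul
      (hde r)).neg).congr_deriv ?_
    simp only [Pi.sub_apply, Nat.add_sub_cancel, Nat.cast_add, Nat.cast_one]
    ring
  have hGint : IntegrableOn (fun r => -((r ^ (m + 1) - a * r ^ m) * e r)) (Set.Ioi a) := by
    refine (((hI (m + 1)).sub ((hI m).const_mul a)).neg).congr (ae_of_all _ fun r => ?_)
    simp only [Pi.neg_apply, Pi.sub_apply]
    ring
  have hG'int : IntegrableOn (fun r => r ^ (m + 2) * e r - a * (r ^ (m + 1) * e r) -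
      (m + 1) * (r ^ m * e r) + a * m * (r ^ (m - 1) * e r)) (Set.Ioi a) :=
    ((((hI (m + 2)).sub ((hI (m + 1)).const_mul a)).sub ((hI m).const_mul _)).add
      ((hI (m - 1)).const_mul _))
  have hlim := tendsto_zero_of_hasDerivAt_of_integrableOn_Ioi (fun r _ => hG r) hG'int hGint
  have hint := integral_Ioi_of_hasDerivAt_of_tendsto' (fun r _ => hG r) hG'int hlim
  have hsq : IntegrableOn (fun r => (r - a) ^ 2 * (r ^ m * e r)) (Set.Ioi a) := by
    refine (((hI (m + 2)).sub ((hI (m + 1)).const_mul (2 * a))).add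
      ((hI m).const_mul (a ^ 2))).congr (ae_of_all _ fun r => ?_)
    simp only [Pi.add_apply, Pi.sub_apply]
    ring
  have hle : ∫ r in Set.Ioi a, ((r - a) ^ 2 * (r ^ m * e r) - ((m : ℝ) + 1) * (r ^ m * e r)) ≤
      ∫ r in Set.Ioi a, (r ^ (m + 2) * e r - a * (r ^ (m + 1) * e r) -
      (m + 1) * (r ^ m * e r) + a * m * (r ^ (m - 1) * e r)) := by
    refine setIntegral_mono_on (hsq.sub ((hI m).const_mul _)) hG'int measurableSet_Ioi
      fun r hr => ?_
    have hr' : a < r := hr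
    have hr0 : 0 ≤ r := ha.trans hr'.le
    have hd : 0 ≤ a * (r - a) * (r ^ m * e r) + a * m * (r ^ (m - 1) * e r) := by
      have : 0 ≤ e r := (Real.exp_pos _).le
      have : 0 ≤ r - a := by linarith
      positivity
    have hsub : (r ^ (m + 2) * e r - a * (r ^ (m + 1) * e r) - (m + 1) * (r ^ m * e r) +
        a * m * (r ^ (m - 1) * e r)) -
        ((r - a) ^ 2 * (r ^ m * e r) - ((m : ℝ) + 1) * (r ^ m * e r)) =
        a * (r - a) * (r ^ m * e r) + a * m * (r ^ (m - 1) * e r) := by ring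
    linarith
  rw [hint, integral_sub hsq ((hI m).const_mul _)] at hle
  have h1 : (a ^ (m + 1) - a * a ^ m) * e a = 0 := by ring
  rw [h1] at hle
  linarith

/-- Comparison along one ray, with `m + 1` in the role of the dimension: pointwise up to the exit
radius `a`, by the integrated inequality beyond it. -/
theorem lintegral_pow_mul_exp_mul_le (m : ℕ) {a : ℝ} (ha : 0 ≤ a) (H : ℝ → ℝ)
    (h1 : ∀ r, 0 < r → r ≤ a → H r ≤ (m : ℝ) + 1) (h2 : ∀ r, a < r → H r ≤ (r - a) ^ 2) :
    ∫⁻ r in Set.Ioi (0 : ℝ), ENNReal.ofReal (H r * (r ^ m * Real.exp (-r ^ 2 / 2))) ≤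
      ∫⁻ r in Set.Ioi (0 : ℝ), ENNReal.ofReal (((m : ℝ) + 1) *
        (r ^ m * Real.exp (-r ^ 2 / 2))) := by
  have hI := integrableOn_pow_mul_exp_neg_sq_div_two m ha
  rw [← Set.Ioc_union_Ioi_eq_Ioi ha, lintegral_union measurableSet_Ioi
    (Set.Ioc_disjoint_Ioi le_rfl), lintegral_union measurableSet_Ioi (Set.Ioc_disjoint_Ioi le_rfl)]
  refine add_le_add (setLIntegral_mono' measurableSet_Ioc fun r hr => ?_) ?_
  · refine ENNReal.ofReal_le_ofReal (mul_le_mul_of_nonneg_right (h1 r hr.1 hr.2) ?_)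
    have := hr.1.le
    positivity
  have hpos : ∀ r ∈ Set.Ioi a, 0 ≤ r ^ m * Real.exp (-r ^ 2 / 2) := fun r hr => by
    have : 0 ≤ r := ha.trans (le_of_lt hr)
    positivity
  have hsq : IntegrableOn (fun r => (r - a) ^ 2 * (r ^ m * Real.exp (-r ^ 2 / 2))) (Set.Ioi a) := by
    refine (((integrableOn_pow_mul_exp_neg_sq_div_two (m + 2) ha).sub
      ((integrableOn_pow_mul_exp_neg_sq_div_two (m + 1) ha).const_mul (2 * a))).add
      (hI.const_mul (a ^ 2))).congr (ae_of_all _ fun r => ?_)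
    simp only [Pi.add_apply, Pi.sub_apply]
    ring
  calc _ ≤ ∫⁻ r in Set.Ioi a,
        ENNReal.ofReal ((r - a) ^ 2 * (r ^ m * Real.exp (-r ^ 2 / 2))) :=
        setLIntegral_mono' measurableSet_Ioi fun r hr =>
          ENNReal.ofReal_le_ofReal (mul_le_mul_of_nonneg_right (h2 r hr) (hpos r hr))
    _ = ENNReal.ofReal (∫ r in Set.Ioi a, (r - a) ^ 2 * (r ^ m * Real.exp (-r ^ 2 / 2))) :=
        (ofReal_integral_eq_lintegral_ofReal hsq ((ae_restrict_iff' measurableSet_Ioi).2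
          (ae_of_all _ fun r hr => mul_nonneg (sq_nonneg _) (hpos r hr)))).symm
    _ ≤ _ := ENNReal.ofReal_le_ofReal (integral_sq_sub_mul_pow_mul_exp_le m ha)
    _ = _ := ofReal_integral_eq_lintegral_ofReal (hI.const_mul _)
        ((ae_restrict_iff' measurableSet_Ioi).2
          (ae_of_all _ fun r hr => mul_nonneg (by positivity) (hpos r hr)))

/-- `n` on the ball of radius `A`, the squared distance to the ball outside of it. -/
noncomputable def ballPenalty (n : ℕ) (A : ℝ) (y : EuclideanSpace ℝ (Fin n)) : ℝ :=
  if ‖y‖ ≤ A then (n : ℝ) else (‖y‖ - A) ^ 2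

@[fun_prop]
theorem measurable_ballPenalty (n : ℕ) (A : ℝ) : Measurable (ballPenalty n A) :=
  Measurable.ite (measurableSet_le (by fun_prop) (by fun_prop)) (by fun_prop) (by fun_prop)

theorem ballPenalty_nonneg (n : ℕ) (A : ℝ) (y : EuclideanSpace ℝ (Fin n)) :
    0 ≤ ballPenalty n A y := by
  unfold ballPenalty; split_ifs <;> positivity

/-- Take `a` to be the last radius at which the ray from `x` is in the ball; it exists by
compactness. Convexity keeps the ray inside up to `a`, and the triangle inequality from the exit
point bounds the distance to the ball afterwards. -/
theorem exists_exit_radius (n : ℕ) {A : ℝ} {x θ : EuclideanSpace ℝ (Fin n)} (hx : ‖x‖ ≤ A)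
    (hθ : ‖θ‖ = 1) :
    ∃ a : ℝ, 0 ≤ a ∧ (∀ r, 0 < r → r ≤ a → ballPenalty n A (x + r • θ) ≤ n) ∧
      ∀ r, a < r → ballPenalty n A (x + r • θ) ≤ (r - a) ^ 2 := by
  have hnorm : ∀ r : ℝ, |r| ≤ ‖x + r • θ‖ + ‖x‖ := fun r => by
    have h : ‖r • θ‖ = |r| := by rw [norm_smul, hθ, mul_one, Real.norm_eq_abs]
    rw [← h]
    calc ‖r • θ‖ = ‖(x + r • θ) - x‖ := by congr 1; abel
      _ ≤ _ := norm_sub_le _ _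
  have hcl : IsClosed {r : ℝ | 0 ≤ r ∧ ‖x + r • θ‖ ≤ A} :=
    (isClosed_le continuous_const continuous_id).inter
      (isClosed_le (f := fun r : ℝ => ‖x + r • θ‖) (by fun_prop) continuous_const)
  have hcpt : IsCompact {r : ℝ | 0 ≤ r ∧ ‖x + r • θ‖ ≤ A} := by
    refine (isCompact_Icc (a := 0) (b := A + A)).of_isClosed_subset hcl fun r hr => ⟨hr.1, ?_⟩
    have := hnorm r
    have := le_abs_self r
    have := hr.2
    linarith
  obtain ⟨a, ⟨ha0, haA⟩, hmax⟩ := hcpt.exists_isGreatest ⟨0, le_rfl, by simpa using hx⟩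
  refine ⟨a, ha0, fun r hr0 hra => ?_, fun r har => ?_⟩
  · have hconv := convex_closedBall (0 : EuclideanSpace ℝ (Fin n)) A
    have hmem := hconv (x := x) (by simpa using hx) (y := x + a • θ) (by simpa using haA)
      (a := 1 - r / a) (b := r / a)
      (sub_nonneg.2 ((div_le_one (hr0.trans_le hra)).2 hra)) (div_nonneg hr0.le ha0) (by ring)
    have hz : (1 - r / a) • x + (r / a) • (x + a • θ) = x + r • θ := by
      rw [smul_add, smul_smul, div_mul_cancel₀ _ (hr0.trans_le hra).ne', sub_smul, one_smul]
      abel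
    rw [hz, mem_closedBall_zero_iff] at hmem
    simp [ballPenalty, hmem]
  · have hout : ¬ ‖x + r • θ‖ ≤ A := fun h => absurd (hmax ⟨ha0.trans har.le, h⟩) (not_le.2 har)
    have hle : ‖x + r • θ‖ ≤ A + (r - a) := by
      calc ‖x + r • θ‖ = ‖(x + a • θ) + (r - a) • θ‖ := by
            congr 1; rw [sub_smul]; abel
        _ ≤ ‖x + a • θ‖ + ‖(r - a) • θ‖ := norm_add_le _ _
        _ ≤ A + (r - a) := by
            rw [norm_smul, hθ, mul_one, Real.norm_eq_abs, abs_of_pos (sub_pos.2 har)]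
            gcongr
    rw [ballPenalty, if_neg hout]
    have := not_le.1 hout
    exact pow_le_pow_left₀ (by linarith) (by linarith) 2

theorem lintegral_ballPenalty_le (n : ℕ) (hn : 1 ≤ n) {A : ℝ} {x : EuclideanSpace ℝ (Fin n)}
    (hx : ‖x‖ ≤ A) :
    ∫⁻ z, ENNReal.ofReal (ballPenalty n A (x + z)) ∂stdGaussian (EuclideanSpace ℝ (Fin n)) ≤
      ENNReal.ofReal n := by
  have hc : (0 : ℝ) ≤ ((2 * Real.pi) ^ ((n : ℝ) / 2))⁻¹ := by positivity
  have hcast : ((n - 1 : ℕ) : ℝ) + 1 = n := by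
    rw [Nat.cast_sub hn]; simp
  have hpolar : ∀ F : EuclideanSpace ℝ (Fin n) → ℝ, Measurable F →
      ∫⁻ z, ENNReal.ofReal (F z) ∂stdGaussian (EuclideanSpace ℝ (Fin n)) =
      ∫⁻ θ : Metric.sphere (0 : EuclideanSpace ℝ (Fin n)) 1,
        ENNReal.ofReal ((2 * Real.pi) ^ ((n : ℝ) / 2))⁻¹ *
        (∫⁻ r in Set.Ioi (0 : ℝ), ENNReal.ofReal (F (r • (θ : EuclideanSpace ℝ (Fin n))) *
          (r ^ (n - 1) * Real.exp (-r ^ 2 / 2))))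
        ∂(volume : Measure (EuclideanSpace ℝ (Fin n))).toSphere := by
    intro F hF
    rw [stdGaussian_eq_withDensity, lintegral_withDensity_eq_lintegral_mul _ (by fun_prop)
      (by fun_prop), lintegral_eq_lintegral_toSphere n hn _ (by fun_prop)]
    refine lintegral_congr fun θ => ?_
    rw [← lintegral_const_mul _ (by fun_prop)]
    refine setLIntegral_congr_fun measurableSet_Ioi fun r hr => ?_
    have hr0 : (0 : ℝ) ≤ r := le_of_lt hr
    have hθ : ‖(θ : EuclideanSpace ℝ (Fin n))‖ = 1 := by simp
    simp only [Pi.mul_apply]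
    rw [stdGaussianPDF, norm_smul, hθ, mul_one, Real.norm_eq_abs, sq_abs,
      ENNReal.ofReal_mul hc, ENNReal.ofReal_mul' (by positivity),
      ENNReal.ofReal_mul (pow_nonneg hr0 _)]
    ring
  -- Writing `n` as the Gaussian mean of a constant puts both sides in the same polar form, so they
  -- can be compared direction by direction.
  calc _ ≤ ∫⁻ _, ENNReal.ofReal n ∂stdGaussian (EuclideanSpace ℝ (Fin n)) := by
        rw [hpolar _ (by fun_prop), hpolar _ (by fun_prop)]
        refine lintegral_mono fun θ => mul_le_mul_right ?_ _
        obtain ⟨a, ha, h1, h2⟩ := exists_exit_radius n (θ := (θ : EuclideanSpace ℝ (Fin n))) hx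
          (by simp)
        have := lintegral_pow_mul_exp_mul_le (n - 1) ha
          (fun r => ballPenalty n A (x + r • (θ : EuclideanSpace ℝ (Fin n))))
          (by rwa [hcast]) h2
        rwa [hcast] at this
    _ = _ := by simp

theorem ballPenalty_le (n : ℕ) {A : ℝ} (hA : 0 ≤ A) (y : EuclideanSpace ℝ (Fin n)) :
    ballPenalty n A y ≤ n + ‖y‖ ^ 2 := by
  unfold ballPenalty
  split_ifs with h
  · nlinarith [sq_nonneg ‖y‖]
  · have : 0 ≤ (n : ℝ) := n.cast_nonneg
    nlinarith [not_le.1 h, norm_nonneg y]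

theorem integral_ballPenalty_le (n : ℕ) (hn : 1 ≤ n) {A : ℝ} {x : EuclideanSpace ℝ (Fin n)}
    (hx : ‖x‖ ≤ A) :
    Integrable (fun z => ballPenalty n A (x + z)) (stdGaussian (EuclideanSpace ℝ (Fin n))) ∧
    ∫ z, ballPenalty n A (x + z) ∂stdGaussian (EuclideanSpace ℝ (Fin n)) ≤ n := by
  have hm : Measurable fun z => ballPenalty n A (x + z) := by fun_prop
  have hnn : 0 ≤ᵐ[stdGaussian (EuclideanSpace ℝ (Fin n))] fun z => ballPenalty n A (x + z) :=
    ae_of_all _ fun z => ballPenalty_nonneg n A _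
  have hle := lintegral_ballPenalty_le n hn hx
  refine ⟨(lintegral_ofReal_ne_top_iff_integrable hm.aestronglyMeasurable hnn).1
    (hle.trans_lt ENNReal.ofReal_lt_top).ne, ?_⟩
  rw [integral_eq_lintegral_of_nonneg_ae hnn hm.aestronglyMeasurable]
  exact ENNReal.toReal_le_of_le_ofReal n.cast_nonneg hle

/-! ### The normalizing constant -/

/-- The term `i = 0` is `1` and the others are nonnegative. This makes the logarithmic bound
nonnegative, as needed to move it between `ℝ≥0∞` and `EReal`. -/
theorem one_le_kConst (n : ℕ) (hn : 1 ≤ n) {A : ℝ} (hA : 0 ≤ A) : 1 ≤ kConst n A := by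
  have hG : 0 < Real.Gamma ((n : ℝ) / 2) := Real.Gamma_pos_of_pos (by positivity)
  have h0 : (1 : ℝ) = ((n - 1).choose 0 : ℝ) * (Real.Gamma (((n : ℝ) - ((0 : ℕ) : ℝ)) / 2) /
      ((2 : ℝ) ^ (((0 : ℕ) : ℝ) / 2) * Real.Gamma ((n : ℝ) / 2))) * A ^ 0 := by
    simp [hG.ne']
  rw [kConst, h0]
  refine Finset.single_le_sum (f := fun i : ℕ => ((n - 1).choose i : ℝ) *
    (Real.Gamma (((n : ℝ) - (i : ℝ)) / 2) /
      ((2 : ℝ) ^ ((i : ℝ) / 2) * Real.Gamma ((n : ℝ) / 2))) * A ^ i) (fun i hi => ?_)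
    (Finset.mem_range.2 hn)
  have hi' : (i : ℝ) < n := by exact_mod_cast Finset.mem_range.1 hi
  have : 0 < Real.Gamma (((n : ℝ) - (i : ℝ)) / 2) := Real.Gamma_pos_of_pos (by linarith)
  positivity

theorem integral_pow_mul_exp_neg_sq_div_two (k : ℕ) :
    ∫ s in Set.Ioi (0 : ℝ), s ^ k * Real.exp (-s ^ 2 / 2) =
      2 ^ (((k : ℝ) + 1) / 2) / 2 * Real.Gamma (((k : ℝ) + 1) / 2) := by
  have hk : (0 : ℝ) ≤ k := k.cast_nonneg
  have h := integral_rpow_mul_exp_neg_mul_rpow (p := 2) (q := k) (b := 1 / 2) (by norm_num)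
    (by linarith) (by norm_num)
  have h2 : ((1 : ℝ) / 2) ^ (-((k : ℝ) + 1) / 2) = 2 ^ (((k : ℝ) + 1) / 2) := by
    rw [neg_div, Real.rpow_neg (by norm_num), one_div, Real.inv_rpow (by norm_num), inv_inv]
  rw [h2] at h
  calc _ = ∫ x in Set.Ioi (0 : ℝ), x ^ (k : ℝ) * Real.exp (-(1 / 2) * x ^ (2 : ℝ)) := by
        refine setIntegral_congr_fun measurableSet_Ioi fun x _ => ?_
        simp only [Real.rpow_natCast, Real.rpow_two]
        ring_nf
    _ = _ := by rw [h]; ring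

theorem integral_add_pow_mul_exp_neg_sq_div_two (n : ℕ) (hn : 1 ≤ n) (A : ℝ) :
    ∫ s in Set.Ioi (0 : ℝ), (s + A) ^ (n - 1) * Real.exp (-s ^ 2 / 2) =
      2 ^ ((n : ℝ) / 2) / 2 * Real.Gamma ((n : ℝ) / 2) * kConst n A := by
  have hG : 0 < Real.Gamma ((n : ℝ) / 2) := Real.Gamma_pos_of_pos (by positivity)
  have h1 : ∀ s : ℝ, (s + A) ^ (n - 1) * Real.exp (-s ^ 2 / 2) =
      ∑ i ∈ Finset.range n, (((n - 1).choose i : ℝ) * A ^ i) *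
        (s ^ (n - 1 - i) * Real.exp (-s ^ 2 / 2)) := fun s => by
    rw [add_comm, add_pow, Nat.sub_add_cancel hn, Finset.sum_mul]
    exact Finset.sum_congr rfl fun i _ => by ring
  simp only [h1]
  rw [integral_finsetSum _ fun i _ =>
    (integrableOn_pow_mul_exp_neg_sq_div_two (n - 1 - i) le_rfl).const_mul _, kConst,
    Finset.mul_sum]
  refine Finset.sum_congr rfl fun i hi => ?_
  have hi' := Finset.mem_range.1 hi
  have hcast : ((n - 1 - i : ℕ) : ℝ) + 1 = n - i := by
    rw [Nat.sub_sub, Nat.cast_sub (by omega)]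
    push_cast
    ring
  rw [integral_const_mul, integral_pow_mul_exp_neg_sq_div_two, hcast, sub_div,
    Real.rpow_sub (by norm_num)]
  field_simp

/-- The integrand is radial; substituting `r = s + A` and expanding `(s + A)^{n-1}` produces the
Gamma sum, and the surface area of the unit sphere cancels the prefactor up to `(2π)^{n/2}`. -/
theorem setLIntegral_exp_neg_sq_norm_sub (n : ℕ) (hn : 1 ≤ n) {A : ℝ} (hA : 0 ≤ A) :
    ∫⁻ y in (Metric.closedBall (0 : EuclideanSpace ℝ (Fin n)) A)ᶜ,
      ENNReal.ofReal (Real.exp (-(‖y‖ - A) ^ 2 / 2)) =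
      ENNReal.ofReal ((2 * Real.pi) ^ ((n : ℝ) / 2) * kConst n A) := by
  have : Nonempty (Fin n) := ⟨⟨0, hn⟩⟩
  have hn0 : (0 : ℝ) < n := by exact_mod_cast hn
  have hG : 0 < Real.Gamma ((n : ℝ) / 2) := Real.Gamma_pos_of_pos (by positivity)
  set F : ℝ → ℝ := (Set.Ioi A).indicator fun r => Real.exp (-(r - A) ^ 2 / 2) with hF
  have hrad : ∫ r in Set.Ioi (0 : ℝ), r ^ (n - 1) • F r =
      2 ^ ((n : ℝ) / 2) / 2 * Real.Gamma ((n : ℝ) / 2) * kConst n A := by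
    rw [← integral_add_pow_mul_exp_neg_sq_div_two n hn]
    have h1 : (fun r => r ^ (n - 1) • F r) =
        (Set.Ioi A).indicator fun r => r ^ (n - 1) * Real.exp (-(r - A) ^ 2 / 2) := by
      funext r
      by_cases hr : r ∈ Set.Ioi A <;> simp [hF, hr]
    have h2 : ∀ s : ℝ, (s + A) ^ (n - 1) * Real.exp (-s ^ 2 / 2) =
        (fun r => r ^ (n - 1) * Real.exp (-(r - A) ^ 2 / 2)) (s + A) := fun s => by simp
    simp only [h2]
    have h3 := (measurePreserving_add_right volume A).setIntegral_preimage_emb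
      (measurableEmbedding_addRight A) (fun r => r ^ (n - 1) * Real.exp (-(r - A) ^ 2 / 2))
      (Set.Ioi A)
    rw [Set.preimage_add_const_Ioi, sub_self] at h3
    rw [h1, setIntegral_indicator measurableSet_Ioi, Set.Ioi_inter_Ioi, max_eq_right hA, h3]
  have hvol : (volume : Measure (EuclideanSpace ℝ (Fin n))).real (Metric.ball 0 1) =
      Real.pi ^ ((n : ℝ) / 2) / Real.Gamma ((n : ℝ) / 2 + 1) := by
    have hp : Real.sqrt Real.pi ^ n = Real.pi ^ ((n : ℝ) / 2) := by
      rw [Real.sqrt_eq_rpow, ← Real.rpow_natCast, ← Real.rpow_mul Real.pi_pos.le]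
      ring_nf
    have hG' : 0 < Real.Gamma ((n : ℝ) / 2 + 1) := Real.Gamma_pos_of_pos (by positivity)
    rw [measureReal_def, EuclideanSpace.volume_ball]
    simp only [ENNReal.ofReal_one, one_pow, one_mul, Fintype.card_fin]
    rw [hp, ENNReal.toReal_ofReal (by positivity)]
  have hval : ∫ y : EuclideanSpace ℝ (Fin n), F ‖y‖ =
      (2 * Real.pi) ^ ((n : ℝ) / 2) * kConst n A := by
    rw [integral_fun_norm_addHaar, finrank_euclideanSpace_fin, hrad, hvol,
      Real.Gamma_add_one (by positivity), Real.mul_rpow (by norm_num) Real.pi_pos.le,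
      nsmul_eq_mul, smul_eq_mul]
    field_simp
  have hpos : 0 < (2 * Real.pi) ^ ((n : ℝ) / 2) * kConst n A :=
    mul_pos (by positivity) (zero_lt_one.trans_le (one_le_kConst n hn hA))
  have hint : Integrable fun y : EuclideanSpace ℝ (Fin n) => F ‖y‖ :=
    Integrable.of_integral_ne_zero (hval ▸ hpos.ne')
  have hnn : ∀ r, 0 ≤ F r := fun r => Set.indicator_nonneg (fun _ _ => (Real.exp_pos _).le) r
  rw [← hval, ofReal_integral_eq_lintegral_ofReal hint (ae_of_all _ fun y => hnn _),
    ← lintegral_indicator measurableSet_closedBall.compl]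
  refine lintegral_congr fun y => ?_
  by_cases hy : A < ‖y‖ <;> simp [hF, hy, Set.indicator]

theorem ballVol_pos (n : ℕ) {A : ℝ} (hA : 0 < A) : 0 < ballVol n A := by
  rw [ballVol, measureReal_def]
  exact ENNReal.toReal_pos (Metric.measure_closedBall_pos volume _ hA).ne'
    measure_closedBall_lt_top.ne

theorem lintegral_testDensity (n : ℕ) (hn : 1 ≤ n) {A : ℝ} (hA : 0 < A) {β k : ℝ} (hβ0 : 0 ≤ β)
    (hβ1 : β ≤ 1) (hk : 0 < k) :
    ∫⁻ y, ENNReal.ofReal (testDensity n A β k y) =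
      ENNReal.ofReal (β + (1 - β) * (kConst n A / k)) := by
  have hV := ballVol_pos n hA
  have hK := one_le_kConst n hn hA.le
  have hc : 0 ≤ (1 - β) / (k * (2 * Real.pi) ^ ((n : ℝ) / 2)) :=
    div_nonneg (by linarith) (by positivity)
  rw [← lintegral_add_compl _ (measurableSet_closedBall (x := (0 : EuclideanSpace ℝ (Fin n)))
    (ε := A)), ENNReal.ofReal_add hβ0 (mul_nonneg (by linarith) (by positivity))]
  congr 1
  · calc _ = ∫⁻ _ in Metric.closedBall (0 : EuclideanSpace ℝ (Fin n)) A,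
          ENNReal.ofReal (β / ballVol n A) := by
          refine setLIntegral_congr_fun measurableSet_closedBall fun y hy => ?_
          simp only [testDensity]
          rw [if_pos (mem_closedBall_zero_iff.1 hy)]
      _ = ENNReal.ofReal (β / ballVol n A) * ENNReal.ofReal (ballVol n A) := by
          rw [setLIntegral_const, ballVol, ofReal_measureReal measure_closedBall_lt_top.ne]
      _ = _ := by
          rw [← ENNReal.ofReal_mul (by positivity), div_mul_cancel₀ _ hV.ne']
  · calc _ = ∫⁻ y in (Metric.closedBall (0 : EuclideanSpace ℝ (Fin n)) A)ᶜ,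
          ENNReal.ofReal ((1 - β) / (k * (2 * Real.pi) ^ ((n : ℝ) / 2))) *
            ENNReal.ofReal (Real.exp (-(‖y‖ - A) ^ 2 / 2)) := by
          refine setLIntegral_congr_fun measurableSet_closedBall.compl fun y hy => ?_
          have hy' : ¬ ‖y‖ ≤ A := fun h => hy (mem_closedBall_zero_iff.2 h)
          simp only [testDensity]
          rw [if_neg hy', ENNReal.ofReal_mul hc]
      _ = _ := by
          rw [lintegral_const_mul _ (by fun_prop), setLIntegral_exp_neg_sq_norm_sub n hn hA.le,
            ← ENNReal.ofReal_mul hc]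
          congr 1
          have : 0 < (2 * Real.pi) ^ ((n : ℝ) / 2) := by positivity
          field_simp

theorem lintegral_testDensity_eq_one_iff (n : ℕ) (hn : 1 ≤ n) {A : ℝ} (hA : 0 < A) {β k : ℝ}
    (hβ0 : 0 ≤ β) (hβ1 : β ≤ 1) (hk : 0 < k) :
    (∫⁻ y, ENNReal.ofReal (testDensity n A β k y) = 1) ↔ (k = kConst n A ∨ β = 1) := by
  rw [lintegral_testDensity n hn hA hβ0 hβ1 hk, ENNReal.ofReal_eq_one]
  constructor
  · intro h
    have h2 : (1 - β) * (kConst n A / k - 1) = 0 := by linarith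
    rcases mul_eq_zero.1 h2 with h3 | h3
    · exact Or.inr (by linarith)
    · left
      have : kConst n A / k = 1 := by linarith
      exact ((div_eq_one_iff_eq hk.ne').1 this).symm
  · rintro (h | h)
    · rw [← h, div_self hk.ne']; ring
    · rw [h]; ring

/-! ### The two test laws -/

theorem supInfo_le_of_testDensity (n : ℕ) (A : ℝ) (q : EuclideanSpace ℝ (Fin n) → ℝ)
    (hq : Measurable q) (hq0 : ∀ y, 0 ≤ q y) (hq1 : ∫⁻ y, ENNReal.ofReal (q y) = 1)
    (g : EuclideanSpace ℝ (Fin n) → EuclideanSpace ℝ (Fin n) → ℝ)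
    (hg : Measurable (Function.uncurry g))
    (h : ∀ x y, q y * Real.exp (g x y) = stdGaussianPDF n (y - x))
    (c L : ℝ) (hc : ∀ x z, ‖x‖ ≤ A → |g x (x + z)| ≤ c * (1 + ‖z‖ ^ 2))
    (hL : ∀ x, ‖x‖ ≤ A → ∫ z, g x (x + z) ∂stdGaussian (EuclideanSpace ℝ (Fin n)) ≤ L) (m : ℕ) :
    supInfo n A m ≤ ENNReal.ofReal (m * L) := by
  have : IsProbabilityMeasure (volume.withDensity fun y => ENNReal.ofReal (q y)) :=
    ⟨by rw [withDensity_apply _ MeasurableSet.univ, Measure.restrict_univ, hq1]⟩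
  exact iSup₂_le fun μ hμ => awgnInfo_le_of_testLaw n m A μ hμ _ g hg
    (map_add_stdGaussian_eq_withDensity_exp n q hq hq0 g hg h) c L hc hL

theorem norm_add_sq_le {E : Type*} [SeminormedAddCommGroup E] {A : ℝ} {x : E} (hx : ‖x‖ ≤ A)
    (z : E) : ‖x + z‖ ^ 2 ≤ 2 * A ^ 2 + 2 * ‖z‖ ^ 2 := by
  have h1 := norm_add_le x z
  have h2 : ‖x + z‖ ^ 2 ≤ (A + ‖z‖) ^ 2 :=
    pow_le_pow_left₀ (norm_nonneg _) (h1.trans (by linarith)) 2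
  nlinarith [sq_nonneg (A - ‖z‖)]

theorem supInfo_le_log_kConst (n : ℕ) (hn : 1 ≤ n) {A : ℝ} (hA : 0 < A) (m : ℕ) :
    supInfo n A m ≤ ENNReal.ofReal (m * Real.log (kConst n A +
      ballVol n A / (2 * Real.pi * Real.exp 1) ^ ((n : ℝ) / 2))) := by
  have hK : 0 < kConst n A := zero_lt_one.trans_le (one_le_kConst n hn hA.le)
  have hVol := ballVol_pos n hA
  set D := (2 * Real.pi * Real.exp 1) ^ ((n : ℝ) / 2) with hD
  have hDpos : 0 < D := by positivity
  set V := ballVol n A / D with hV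
  have hVpos : 0 < V := div_pos hVol hDpos
  set K := kConst n A
  set L := Real.log (K + V) with hLdef
  have hexpL : Real.exp L = K + V := Real.exp_log (by positivity)
  -- This weight gives both branches of the density the common factor `1/(K + V)`, so that the
  -- log-density has the same constant `L` inside and outside the ball.
  set β := V / (K + V) with hβ
  have hβ0 : 0 ≤ β := by positivity
  have hβ1 : β ≤ 1 := (div_le_one (by positivity)).2 (by linarith)
  have hβ' : 1 - β = K / (K + V) := by rw [hβ]; field_simp; ring
  have hDeq : D = (2 * Real.pi) ^ ((n : ℝ) / 2) * Real.exp ((n : ℝ) / 2) := by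
    rw [hD, Real.mul_rpow (by positivity) (by positivity), Real.exp_one_rpow]
  refine supInfo_le_of_testDensity n A (testDensity n A β K) ?_ ?_ ?_
    (fun x y => L + ballPenalty n A y / 2 - ‖y - x‖ ^ 2 / 2) (by fun_prop) ?_
    -- A crude growth constant: by `norm_add_sq_le` the penalty is at most `n + 2A² + 2‖z‖²`, and
    -- half of it plus `‖z‖²/2` needs only `3/2` in front of `‖z‖²`.
    (|L| + n + A ^ 2 + 2) L ?_ ?_ m
  · exact Measurable.ite (measurableSet_le (by fun_prop) (by fun_prop)) (by fun_prop)
      (by fun_prop)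
  · intro y
    unfold testDensity
    have : 0 ≤ 1 - β := by linarith
    split_ifs <;> positivity
  · exact (lintegral_testDensity_eq_one_iff n hn hA hβ0 hβ1 hK).2 (Or.inl rfl)
  · intro x y
    have hP : 0 < (2 * Real.pi) ^ ((n : ℝ) / 2) := by positivity
    rw [sub_eq_add_neg, Real.exp_add, Real.exp_add, hexpL, stdGaussianPDF, ← neg_div]
    by_cases hy : ‖y‖ ≤ A
    · rw [testDensity, if_pos hy, ballPenalty, if_pos hy, hβ, hV, hDeq]
      have := Real.exp_pos ((n : ℝ) / 2)
      field_simp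
    · rw [testDensity, if_neg hy, ballPenalty, if_neg hy, hβ', neg_div ((2 : ℝ)) ((‖y‖ - A) ^ 2),
        Real.exp_neg]
      have := Real.exp_pos ((‖y‖ - A) ^ 2 / 2)
      field_simp
  · intro x z hx
    have h1 := ballPenalty_nonneg n A (x + z)
    have h2 := ballPenalty_le n hA.le (x + z)
    have h3 := norm_add_sq_le hx z
    have h4 := abs_le.1 (le_refl |L|)
    have h5 : 0 ≤ (|L| + n + A ^ 2) * ‖z‖ ^ 2 := by positivity
    have h6 : (0 : ℝ) ≤ n := n.cast_nonneg
    have h7 := sq_nonneg ‖z‖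
    have h8 := sq_nonneg A
    rw [add_sub_cancel_left, abs_le]
    constructor <;> nlinarith
  · intro x hx
    obtain ⟨hi, hle⟩ := integral_ballPenalty_le n hn hx
    have hz := integrable_sq_norm_stdGaussian n
    simp only [add_sub_cancel_left]
    rw [integral_sub (by exact (integrable_const L).add (hi.div_const 2)) (hz.div_const 2),
      integral_add (integrable_const L) (hi.div_const 2), integral_div, integral_div,
      integral_sq_norm_stdGaussian]
    simp only [integral_const, probReal_univ, one_smul]
    linarith

/-- The test law is `N(0,(1+P)I)`. Since `‖x‖² ≤ nP`, the mean of `‖x+Z‖²/(2(1+P))` is at most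
`n/2`, which the noise term `E‖Z‖²/2 = n/2` cancels. -/
theorem supInfo_le_half_log (n : ℕ) {P : ℝ} (hP : 0 < P) (m : ℕ) :
    supInfo n (Real.sqrt ((n : ℝ) * P)) m ≤
      ENNReal.ofReal (m * ((n : ℝ) / 2 * Real.log (1 + P))) := by
  set A := Real.sqrt ((n : ℝ) * P) with hA
  have hn0 : (0 : ℝ) ≤ n := n.cast_nonneg
  have hA2 : A ^ 2 = n * P := Real.sq_sqrt (by positivity)
  have hP1 : 0 < 1 + P := by linarith
  set L := (n : ℝ) / 2 * Real.log (1 + P) with hL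
  have hL0 : 0 ≤ L := mul_nonneg (by positivity) (Real.log_nonneg (by linarith))
  set D := (2 * Real.pi * (1 + P)) ^ ((n : ℝ) / 2) with hD
  have hDpos : 0 < D := by positivity
  have hDeq : D = (2 * Real.pi) ^ ((n : ℝ) / 2) * Real.exp L := by
    rw [hD, Real.mul_rpow (by positivity) hP1.le, Real.rpow_def_of_pos hP1, hL, mul_comm (n / 2 : ℝ)]
  have hint := integrable_exp_neg_mul_sq_norm n (b := 1 / (2 * (1 + P))) (by positivity)
  refine supInfo_le_of_testDensity n A
    (fun y => D⁻¹ * Real.exp (-(1 / (2 * (1 + P))) * ‖y‖ ^ 2)) (by fun_prop)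
    (fun y => by positivity) ?_
    (fun x y => L + 1 / (2 * (1 + P)) * ‖y‖ ^ 2 - ‖y - x‖ ^ 2 / 2) (by fun_prop) ?_
    (L + A ^ 2 + 2) L ?_ ?_ m
  · rw [← ofReal_integral_eq_lintegral_ofReal (hint.const_mul _)
      (ae_of_all _ fun y => by positivity), integral_const_mul,
      GaussianFourier.integral_rexp_neg_mul_sq_norm (by positivity), finrank_euclideanSpace_fin]
    have : Real.pi / (1 / (2 * (1 + P))) = 2 * Real.pi * (1 + P) := by field_simp
    rw [this, inv_mul_cancel₀ hDpos.ne', ENNReal.ofReal_one]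
  · intro x y
    rw [sub_eq_add_neg, Real.exp_add, Real.exp_add, stdGaussianPDF,
      ← neg_div 2 (‖y - x‖ ^ 2), hDeq, neg_mul,
      Real.exp_neg]
    have := Real.exp_pos L
    have := Real.exp_pos (1 / (2 * (1 + P)) * ‖y‖ ^ 2)
    generalize Real.exp (1 / (2 * (1 + P)) * ‖y‖ ^ 2) = E at *
    field_simp
  · intro x z hx
    have h1 : 1 / (2 * (1 + P)) ≤ 1 / 2 := by
      apply one_div_le_one_div_of_le <;> linarith
    have h0 : 0 ≤ 1 / (2 * (1 + P)) := by positivity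
    have h2 : 1 / (2 * (1 + P)) * ‖x + z‖ ^ 2 ≤ 1 / 2 * ‖x + z‖ ^ 2 := by gcongr
    have h2' : 0 ≤ 1 / (2 * (1 + P)) * ‖x + z‖ ^ 2 := by positivity
    have h3 := norm_add_sq_le hx z
    have h5 : 0 ≤ (L + A ^ 2) * ‖z‖ ^ 2 := by positivity
    have h7 := sq_nonneg ‖z‖
    have h8 := sq_nonneg A
    rw [add_sub_cancel_left, abs_le]
    constructor <;> nlinarith
  · intro x hx
    obtain ⟨hi, heq⟩ := integral_sq_norm_add_stdGaussian n x
    have hz := integrable_sq_norm_stdGaussian n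
    simp only [add_sub_cancel_left]
    rw [integral_sub (by exact (integrable_const L).add (hi.const_mul _)) (hz.div_const 2),
      integral_add (integrable_const L) (hi.const_mul _), integral_div,
      integral_const_mul (1 / (2 * (1 + P))), heq,
      integral_sq_norm_stdGaussian]
    simp only [integral_const, probReal_univ, one_smul]
    have hx2 : ‖x‖ ^ 2 ≤ n * P := hA2 ▸ pow_le_pow_left₀ (norm_nonneg _) hx 2
    have h1 : 1 / (2 * (1 + P)) * (‖x‖ ^ 2 + n) ≤ 1 / (2 * (1 + P)) * (n * (1 + P)) := by
      gcongr
      linarith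
    have h2 : 1 / (2 * (1 + P)) * (n * (1 + P)) = (n : ℝ) / 2 := by field_simp
    linarith

theorem mainTheorem4 (n : ℕ) (hn : 1 ≤ n) :
    (∀ A : ℝ, 0 < A →
      -- the test function is a probability density exactly for `k = k_n(A)` (for any `k` if `β = 1`)
      (∀ β : ℝ, 0 ≤ β → β ≤ 1 → ∀ k : ℝ, 0 < k →
        ((∫⁻ y, ENNReal.ofReal (testDensity n A β k y) = 1) ↔ (k = kConst n A ∨ β = 1))) ∧
      -- the limit that defines the capacity exists
      Tendsto (blockCapacity n A) atTop (𝓝 (awgnCapacity n A)) ∧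
      (awgnCapacity n A : EReal) ≤
        ((Real.log (kConst n A +
          ballVol n A / (2 * Real.pi * Real.exp 1) ^ ((n : ℝ) / 2)) : ℝ) : EReal)) ∧
    (∀ P : ℝ, 0 < P →
      (awgnCapacity n (Real.sqrt ((n : ℝ) * P)) : EReal) ≤
        ((min
          (Real.log (kConst n (Real.sqrt ((n : ℝ) * P)) +
            ballVol n (Real.sqrt ((n : ℝ) * P)) /
              (2 * Real.pi * Real.exp 1) ^ ((n : ℝ) / 2)))
          ((n : ℝ) / 2 * Real.log (1 + P)) : ℝ) : EReal)) := by
  have hlog : ∀ A : ℝ, 0 < A → 0 ≤ Real.log (kConst n A +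
      ballVol n A / (2 * Real.pi * Real.exp 1) ^ ((n : ℝ) / 2)) := fun A hA => by
    refine Real.log_nonneg ((one_le_kConst n hn hA.le).trans (le_add_of_nonneg_right ?_))
    have := ballVol_pos n hA
    positivity
  refine ⟨fun A hA => ⟨fun β hβ0 hβ1 k hk =>
    lintegral_testDensity_eq_one_iff n hn hA hβ0 hβ1 hk,
    tendsto_blockCapacity n A hA.le _ (supInfo_le_log_kConst n hn hA),
    awgnCapacity_le n A _ (hlog A hA) (supInfo_le_log_kConst n hn hA)⟩, fun P hP => ?_⟩
  have hA : 0 < Real.sqrt ((n : ℝ) * P) := Real.sqrt_pos.2 (by positivity)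
  rcases min_choice (Real.log (kConst n (Real.sqrt ((n : ℝ) * P)) +
      ballVol n (Real.sqrt ((n : ℝ) * P)) / (2 * Real.pi * Real.exp 1) ^ ((n : ℝ) / 2)))
      ((n : ℝ) / 2 * Real.log (1 + P)) with h | h <;> rw [h]
  · exact awgnCapacity_le n _ _ (hlog _ hA) (supInfo_le_log_kConst n hn hA)
  · exact awgnCapacity_le n _ _
      (mul_nonneg (by positivity) (Real.log_nonneg (by linarith))) (supInfo_le_half_log n hP)
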